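/- Let $a,b,c$ be the automorphisms of the ternary rooted tree (acting on finite words over $\{0,1,2\}$, and written in the form $g=\alpha(g_0,g_1,g_2)$, meaning $g(xw)=\alpha(x)\,g_x(w)$) given by $$a=(01)(id,id,a),\qquad b=(02)(id,b,id),\qquad c=(12)(c,id,id);$$ they generate the Hanoi Towers group $H^{(3)}$. For $n\ge 1$ let $\Sigma_n$ be the $n$-th Schreier graph of $H^{(3)}$ with its loops deleted: its vertices are the words of length $n$ over $\{0,1,2\}$, and two distinct words $u,v$ are joined by an edge labelled $g\in\{a,b,c\}$ if $g(u)=v$. The outmost vertices of $\Sigma_n$ are $0^n$ (leftmost), $1^n$ (upmost) and $2^n$ (rightmost). A spanning $k$-forest of $\Sigma_n$ is an acyclic subgraph with the same vertex set and with exactly $k$ connected components. Let $T_n(a,b,c)$ be the generating function of the spanning trees of $\Sigma_n$, each tree being weighted by the product of the weights $a,b,c$ of the labels of its edges. Let $U_n$ (respectively $R_n$, $L_n$) be the analogous generating function of the spanning $2$-forests in which the upmost (respectively rightmost, leftmost) vertex lies in one component and the two other outmost vertices lie in the other component, and let $Q_n$ be that of the spanning $3$-forests in which the three outmost vertices lie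 in three different components. Let $\tau_n$ be the number of spanning trees of $\Sigma_n$, let $s_n$ be the number of spanning $2$-forests of $\Sigma_n$ in which two fixed outmost vertices lie in the same component and the third one lies in the other component, and let $q_n$ be the number of spanning $3$-forests of $\Sigma_n$ in which each component contains exactly one outmost vertex. Then, for every $n\ge 1$, the number $s_n$ does not depend on the choice of the two outmost vertices, $$\tau_n=T_n(1,1,1),\qquad s_n=U_n(1,1,1)=R_n(1,1,1)=L_n(1,1,1),\qquad q_n=Q_n(1,1,1),$$ and $$\tau_{n+1}=3\tau_n^3+6\tau_n^2s_n,$$ $$s_{n+1}=\tau_n^3+7\tau_n^2s_n+7\tau_ns_n^2+\tau_n^2q_n,$$ $$q_{n+1}=3\tau_n^2q_n+12\tau_ns_nq_n+14s_n^3+12\tau_n^2s_n+\tau_n^3+36\tau_ns_n^2,$$ with initial conditions $\tau_1=3$ and $s_1=q_1=1$. -/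

import Mathlib

/-- The three standard generators `a`, `b`, `c` of the Hanoi Towers group `H^(3)`. -/
inductive HanoiGen where
  | a
  | b
  | c

namespace HanoiGen

/-- Action of a generator on the first level of the ternary tree:
`(01)`, `(02)`, `(12)` respectively. -/
def rootPerm : HanoiGen → Equiv.Perm (Fin 3)
  | a => Equiv.swap 0 1
  | b => Equiv.swap 0 2
  | c => Equiv.swap 1 2

/-- The letter `x` at which the restriction of the generator to the subtree rooted at `x` is the
generator itself; at the two other letters the restriction is the identity. -/
def selfLetter : HanoiGen → Fin 3
  | a => 2
  | b => 1
  | c => 0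

/-- The generators as maps on finite words over `{0, 1, 2}`, given by the self-similar form
`a = (01)(id, id, a)`, `b = (02)(id, b, id)`, `c = (12)(c, id, id)`,
where `g = α(g_0, g_1, g_2)` means `g(xw) = α(x) g_x(w)`. -/
def act (g : HanoiGen) : List (Fin 3) → List (Fin 3)
  | [] => []
  | x :: w => g.rootPerm x :: (if x = g.selfLetter then act g w else w)

theorem length_act (g : HanoiGen) (w : List (Fin 3)) : (g.act w).length = w.length := by
  induction w with
  | nil => rfl
  | cons x w ih => by_cases h : x = g.selfLetter <;> simp [act, h, ih]

theorem act_act (g : HanoiGen) (w : List (Fin 3)) : g.act (g.act w) = w := by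
  induction w with
  | nil => rfl
  | cons x w ih =>
    have h1 : g.rootPerm (g.rootPerm x) = x := by cases g <;> simp [rootPerm]
    have h2 : g.rootPerm x = g.selfLetter ↔ x = g.selfLetter := by
      cases g <;> revert x <;> decide
    by_cases h : x = g.selfLetter
    · have h3 := h2.mpr h
      simp only [act, if_pos h, if_pos h3, h1, ih]
    · have h3 := fun h' => h (h2.mp h')
      simp only [act, if_neg h, if_neg h3, h1]

/-- The action of a generator on the `n`-th level of the tree (words of length `n`). -/
def levelAct (g : HanoiGen) {n : ℕ} (v : List.Vector (Fin 3) n) : List.Vector (Fin 3) n :=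
  ⟨g.act v.1, (g.length_act v.1).trans v.2⟩

theorem levelAct_levelAct (g : HanoiGen) {n : ℕ} (v : List.Vector (Fin 3) n) :
    g.levelAct (g.levelAct v) = v :=
  Subtype.ext (g.act_act v.1)

/-- Two different generators never join the same two distinct words, so an edge of the Schreier
graph carries exactly one label. -/
theorem eq_of_act_eq {g h : HanoiGen} {w : List (Fin 3)} (hne : g.act w ≠ w)
    (heq : g.act w = h.act w) : g = h := by
  induction w with
  | nil => exact absurd rfl hne
  | cons x w ih =>
    simp only [act, List.cons.injEq] at heq
    simp only [act, ne_eq, List.cons.injEq] at hne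
    obtain ⟨h1, h2⟩ := heq
    cases g <;> cases h <;> fin_cases x <;>
      simp_all [rootPerm, selfLetter, Equiv.swap_apply_def]

end HanoiGen

/-- The `n`-th Schreier graph `Σ_n` of the Hanoi Towers group, without its loops: the vertices are
the words of length `n` over `{0, 1, 2}`, and two distinct words are adjacent when some generator
maps one to the other. -/
def hanoiGraph (n : ℕ) : SimpleGraph (List.Vector (Fin 3) n) where
  Adj u v := u ≠ v ∧ ∃ g : HanoiGen, g.levelAct u = v
  symm := ⟨by
    rintro u v ⟨hne, g, hg⟩
    exact ⟨hne.symm, g, by rw [← hg, g.levelAct_levelAct]⟩⟩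
  loopless := ⟨fun _ h => h.1 rfl⟩

/-- The outmost vertex `iⁿ` of `Σ_n`: `0ⁿ` is the leftmost one, `1ⁿ` the upmost one and `2ⁿ` the
rightmost one. -/
def hanoiCorner (n : ℕ) (i : Fin 3) : List.Vector (Fin 3) n :=
  List.Vector.replicate n i

/-- `F` is a spanning `k`-forest of `G`: a subgraph of `G` on the whole vertex set of `G` which is
acyclic and has exactly `k` connected components. -/
def IsSpanningForest {V : Type*} (G F : SimpleGraph V) (k : ℕ) : Prop :=
  F ≤ G ∧ F.IsAcyclic ∧ Nat.card F.ConnectedComponent = k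

/-- The spanning trees of `Σ_n`. -/
def hanoiTrees (n : ℕ) : Set (SimpleGraph (List.Vector (Fin 3) n)) :=
  {F | F ≤ hanoiGraph n ∧ F.IsTree}

/-- The spanning 2-forests of `Σ_n` in which the outmost vertex `iⁿ` lies in one component and the
two other outmost vertices lie in the other component. -/
def hanoiTwoForests (n : ℕ) (i : Fin 3) : Set (SimpleGraph (List.Vector (Fin 3) n)) :=
  {F | IsSpanningForest (hanoiGraph n) F 2 ∧
    (∀ j k, j ≠ i → k ≠ i → F.Reachable (hanoiCorner n j) (hanoiCorner n k)) ∧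
    (∀ j, j ≠ i → ¬ F.Reachable (hanoiCorner n i) (hanoiCorner n j))}

/-- The spanning 3-forests of `Σ_n` in which the three outmost vertices lie in three different
components. -/
def hanoiThreeForests (n : ℕ) : Set (SimpleGraph (List.Vector (Fin 3) n)) :=
  {F | IsSpanningForest (hanoiGraph n) F 3 ∧
    ∀ i j, i ≠ j → ¬ F.Reachable (hanoiCorner n i) (hanoiCorner n j)}

open Classical in
/-- The weight of an edge of `Σ_n`: an edge labelled by the generator `a` (resp. `b`, `c`) has
weight `a` (resp. `b`, `c`). -/
noncomputable def hanoiWeight (n : ℕ) (a b c : ℝ) (e : Sym2 (List.Vector (Fin 3) n)) : ℝ :=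
  if ∃ u, e = s(u, HanoiGen.a.levelAct u) then a
  else if ∃ u, e = s(u, HanoiGen.b.levelAct u) then b
  else if ∃ u, e = s(u, HanoiGen.c.levelAct u) then c
  else 0

open Classical in
/-- The weighted generating function `∑_{F ∈ 𝓕} ∏_{e ∈ E(F)} w(e)` of a family `𝓕` of spanning
subgraphs of `Σ_n`. -/
noncomputable def hanoiGenFun (n : ℕ) (𝓕 : Set (SimpleGraph (List.Vector (Fin 3) n)))
    (a b c : ℝ) : ℝ :=
  ∑ F ∈ Finset.univ.filter (· ∈ 𝓕), ∏ e ∈ F.edgeFinset, hanoiWeight n a b c e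

/-- `T_n(a,b,c)`: generating function of the spanning trees of `Σ_n`. -/
noncomputable def hanoiT (n : ℕ) (a b c : ℝ) : ℝ := hanoiGenFun n (hanoiTrees n) a b c

/-- `U_n(a,b,c)`: generating function of the 2-forests separating the upmost vertex from the two
other outmost vertices. -/
noncomputable def hanoiU (n : ℕ) (a b c : ℝ) : ℝ := hanoiGenFun n (hanoiTwoForests n 1) a b c

/-- `R_n(a,b,c)`: generating function of the 2-forests separating the rightmost vertex from the two
other outmost vertices. -/
noncomputable def hanoiR (n : ℕ) (a b c : ℝ) : ℝ := hanoiGenFun n (hanoiTwoForests n 2) a b c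

/-- `L_n(a,b,c)`: generating function of the 2-forests separating the leftmost vertex from the two
other outmost vertices. -/
noncomputable def hanoiL (n : ℕ) (a b c : ℝ) : ℝ := hanoiGenFun n (hanoiTwoForests n 0) a b c

/-- `Q_n(a,b,c)`: generating function of the 3-forests separating the three outmost vertices. -/
noncomputable def hanoiQ (n : ℕ) (a b c : ℝ) : ℝ := hanoiGenFun n (hanoiThreeForests n) a b c

/-- `τ_n`: the complexity (number of spanning trees) of `Σ_n`. -/
noncomputable def hanoiTau (n : ℕ) : ℕ := (hanoiTrees n).ncard

/-- `s_n`: the number of spanning 2-forests of `Σ_n` in which two fixed outmost vertices lie in the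
same component and the third one lies in the other component. The definition takes `1ⁿ` as the
third vertex; that the choice is immaterial is a claim to be proved. -/
noncomputable def hanoiS (n : ℕ) : ℕ := (hanoiTwoForests n 1).ncard

/-- `q_n`: the number of spanning 3-forests of `Σ_n` in which each component contains exactly one
outmost vertex. -/
noncomputable def hanoiQCount (n : ℕ) : ℕ := (hanoiThreeForests n).ncard

/-! Sort words of length n + 1 by their last letter. A generator with self letter `k` changes only
the part before the last letter, unless that part is `kⁿ`; then it permutes the last letter instead.
Hence `Σ_{n+1}` consists of three copies of `Σ_n`, together with one bridge for each `k`, joining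
the `k`-th corners of the two copies other than copy `k`; the outmost vertices are the `i`-th
corners of copies `i` (`comap_snocEquiv_hanoiGraph`).

All five families counted consist of spanning forests in which each component contains a corner;
they are told apart by the partition induced on the corners (`cornerForests`). Such a forest of the
glued graph is the same as three such forests and a set of bridges, and whether the result is
acyclic, spanning and of the required type depends only on the three partitions and the bridges
(`glue_mem_cornerForests_iff`). So each count is a sum, over finitely many admissible
configurations, of products of three smaller counts (`ncard_cornerForests_glue`). Enumerating these
configurations gives the coefficients (`map_blockProfile_glueOk`).

The enumeration also shows, by induction, that a count depends only on the number of blocks, which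
gives the symmetry of `s_n`. The induction starts at level 0, a single vertex with counts 1, 0, 0;
one step of the recursion then yields 3, 1, 1. -/

/-! ### Partitions of three corners -/

/-- The partitions of the set of the three corners of a triangle-like graph. -/
inductive CornerPartition where
  | joined
  | isolating (i : Fin 3)
  | discrete
  deriving DecidableEq, Fintype

namespace CornerPartition

/-- The equivalence relation on the corners that belongs to a partition. -/
def rel : CornerPartition → Fin 3 → Fin 3 → Bool
  | joined, _, _ => true
  | isolating i, j, k => (j == i) == (k == i)
  | discrete, j, k => j == k

/-- The number of blocks of a partition, counted from zero. -/
def kind : CornerPartition → Fin 3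
  | joined => 0
  | isolating _ => 1
  | discrete => 2

theorem rel_injective {s t : CornerPartition} (h : ∀ i j, s.rel i j = t.rel i j) : s = t := by
  revert s t
  decide

/-- By transitivity, exactly two of the three pairs cannot be related; the other five of the eight
cases are the five partitions. -/
theorem exists_rel {r : Fin 3 → Fin 3 → Prop} (hr : Equivalence r) :
    ∃ t : CornerPartition, ∀ i j, r i j ↔ t.rel i j = true := by
  have hs : ∀ i j, r i j ↔ r j i := fun i j => ⟨hr.symm, hr.symm⟩
  have ht : ∀ {i j k}, r i j → r j k → r i k := hr.trans
  have h0 := hr.refl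
  by_cases h01 : r 0 1 <;> by_cases h02 : r 0 2 <;> by_cases h12 : r 1 2
  · exact ⟨joined, by simp [Fin.forall_fin_succ, rel, *, hs 1 0, hs 2 0, hs 2 1]⟩
  · exact absurd (ht ((hs _ _).1 h01) h02) h12
  · exact absurd (ht h01 h12) h02
  · exact ⟨isolating 2, by simp [Fin.forall_fin_succ, rel, *, hs 1 0, hs 2 0, hs 2 1]⟩
  · exact absurd (ht h02 ((hs _ _).1 h12)) h01
  · exact ⟨isolating 1, by simp [Fin.forall_fin_succ, rel, *, hs 1 0, hs 2 0, hs 2 1]⟩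
  · exact ⟨isolating 0, by simp [Fin.forall_fin_succ, rel, *, hs 1 0, hs 2 0, hs 2 1]⟩
  · exact ⟨discrete, by simp [Fin.forall_fin_succ, rel, *, hs 1 0, hs 2 0, hs 2 1]⟩

end CornerPartition

/-! ### Boolean model of gluing, on the nine corners of three copies -/

/-- The relation obtained from `R` by joining the classes of `u` and `v`. -/
def linkRel {α : Type*} (R : α → α → Bool) (u v x y : α) : Bool :=
  R x y || (R x u && R v y) || (R x v && R u y)

/-- The effect on the connection relation `R` of nine corners of adding, if `b` holds, the bridge
between the `k`-th corners of the copies `k + 1` and `k + 2`. -/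
def bridgeRel (R : Fin 3 × Fin 3 → Fin 3 × Fin 3 → Bool) (k : Fin 3) (b : Bool) :
    Fin 3 × Fin 3 → Fin 3 × Fin 3 → Bool :=
  bif b then linkRel R (k, k + 1) (k, k + 2) else R

/-- Adding the `k`-th bridge if `b` holds closes no cycle. -/
def bridgeOk (R : Fin 3 × Fin 3 → Fin 3 × Fin 3 → Bool) (k : Fin 3) (b : Bool) : Bool :=
  !(b && R (k, k + 1) (k, k + 2))

/-- The connection relation of the corners of three disjoint copies; `(j, i)` is the `j`-th corner
of the `i`-th copy. -/
def copiesRel (p : Fin 3 → CornerPartition) (x y : Fin 3 × Fin 3) : Bool :=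
  x.2 == y.2 && (p x.2).rel x.1 y.1

/-- The connection relation of the corners of three copies with the bridges in `S`. -/
def glueRel (p : Fin 3 → CornerPartition) (S : Fin 3 → Bool) :
    Fin 3 × Fin 3 → Fin 3 × Fin 3 → Bool :=
  bridgeRel (bridgeRel (bridgeRel (copiesRel p) 0 (S 0)) 1 (S 1)) 2 (S 2)

/-- Gluing three forests with corner partitions `p` along the bridges in `S` gives a forest with
corner partition `t`, all of whose components contain an outer corner. -/
def glueOk (p : Fin 3 → CornerPartition) (S : Fin 3 → Bool) (t : CornerPartition) : Bool :=
  bridgeOk (copiesRel p) 0 (S 0) && bridgeOk (bridgeRel (copiesRel p) 0 (S 0)) 1 (S 1) &&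
  bridgeOk (bridgeRel (bridgeRel (copiesRel p) 0 (S 0)) 1 (S 1)) 2 (S 2) &&
  ((List.finRange 3).all fun i => (List.finRange 3).all fun j =>
    glueRel p S (i, i) (j, j) == t.rel i j) &&
  (List.finRange 3).all fun i => (List.finRange 3).all fun j => (List.finRange 3).any fun k =>
    glueRel p S (j, i) (k, k)

/-! ### Spanning forests of three glued copies of a graph -/

namespace SimpleGraph

/-- The spanning forests of `G` all of whose components contain a corner, and which induce the
partition `t` on the corners. -/
def cornerForests {V : Type*} (G : SimpleGraph V) (κ : Fin 3 → V) (t : CornerPartition) :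
    Set (SimpleGraph V) :=
  {F | F ≤ G ∧ F.IsAcyclic ∧ (∀ v, ∃ i, F.Reachable v (κ i)) ∧
    ∀ i j, F.Reachable (κ i) (κ j) ↔ t.rel i j = true}

theorem reachable_sup_edge_iff {V : Type*} {H : SimpleGraph V} {u v x y : V} :
    (H ⊔ edge u v).Reachable x y ↔
      H.Reachable x y ∨ (H.Reachable x u ∧ H.Reachable v y) ∨
        (H.Reachable x v ∧ H.Reachable u y) := by
  constructor
  · intro h
    rw [reachable_iff_reflTransGen] at h
    induction h with
    | refl => exact Or.inl .rfl
    | @tail y z _ hyz ih =>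
      rw [sup_adj, edge_adj] at hyz
      rcases hyz with hyz | ⟨⟨rfl, rfl⟩ | ⟨rfl, rfl⟩, -⟩
      · have := hyz.reachable
        exact ih.imp (·.trans this)
          (Or.imp (And.imp_right (·.trans this)) (And.imp_right (·.trans this)))
      · rcases ih with h | ⟨h, h'⟩ | ⟨h, h'⟩
        · exact Or.inr (Or.inl ⟨h, .rfl⟩)
        · exact Or.inr (Or.inl ⟨h, .rfl⟩)
        · exact Or.inl h
      · rcases ih with h | ⟨h, h'⟩ | ⟨h, h'⟩
        · exact Or.inr (Or.inr ⟨h, .rfl⟩)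
        · exact Or.inl h
        · exact Or.inr (Or.inr ⟨h, .rfl⟩)
  · have hle : H ≤ H ⊔ edge u v := le_sup_left
    have huv : (H ⊔ edge u v).Reachable u v := by
      by_cases h : u = v
      · rw [h]
      · exact Adj.reachable (by simp [edge_adj, h])
    rintro (h | ⟨h, h'⟩ | ⟨h, h'⟩)
    · exact h.mono hle
    · exact (h.mono hle).trans (huv.trans (h'.mono hle))
    · exact (h.mono hle).trans (huv.symm.trans (h'.mono hle))

section Glue

variable {V : Type*}

/-- The disjoint union of three graphs on copies of the same vertex set. -/
def copies (A : Fin 3 → SimpleGraph V) : SimpleGraph (V × Fin 3) where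
  Adj x y := x.2 = y.2 ∧ (A x.2).Adj x.1 y.1
  symm := ⟨by
    rintro ⟨u, i⟩ ⟨v, j⟩ ⟨h, h'⟩
    obtain rfl : i = j := h
    exact ⟨rfl, h'.symm⟩⟩
  loopless := ⟨fun _ h => h.2.ne rfl⟩

/-- Adds, if `b` holds, the bridge between the `k`-th corners of the copies `k + 1` and `k + 2`. -/
def bridge (κ : Fin 3 → V) (H : SimpleGraph (V × Fin 3)) (k : Fin 3) (b : Bool) :
    SimpleGraph (V × Fin 3) :=
  bif b then H ⊔ edge (κ k, k + 1) (κ k, k + 2) else H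

/-- Three graphs glued along those of the three bridges that are in `S`. -/
def glue (κ : Fin 3 → V) (A : Fin 3 → SimpleGraph V) (S : Fin 3 → Bool) :
    SimpleGraph (V × Fin 3) :=
  bridge κ (bridge κ (bridge κ (copies A) 0 (S 0)) 1 (S 1)) 2 (S 2)

theorem copies_reachable_iff {A : Fin 3 → SimpleGraph V} {x y : V × Fin 3} :
    (copies A).Reachable x y ↔ x.2 = y.2 ∧ (A x.2).Reachable x.1 y.1 := by
  constructor
  · intro h
    rw [reachable_iff_reflTransGen] at h
    induction h with
    | refl => exact ⟨rfl, .rfl⟩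
    | tail _ hyz ih => exact ⟨ih.1.trans hyz.1, ih.2.trans (ih.1 ▸ hyz.2.reachable)⟩
  · obtain ⟨u, i⟩ := x
    obtain ⟨v, j⟩ := y
    rintro ⟨h, h'⟩
    obtain rfl : i = j := h
    exact h'.map (⟨fun w => (w, i), fun h => ⟨rfl, h⟩⟩ : A i →g copies A)

theorem comap_copies (A : Fin 3 → SimpleGraph V) (i : Fin 3) :
    (copies A).comap (fun v => (v, i)) = A i := by
  ext u v
  simp [copies]

theorem copies_isAcyclic_iff {A : Fin 3 → SimpleGraph V} :
    (copies A).IsAcyclic ↔ ∀ i, (A i).IsAcyclic := by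
  constructor
  · intro h i
    rw [← comap_copies A i]
    exact IsAcyclic.of_comap ⟨fun v => (v, i), fun u v h => congrArg Prod.fst h⟩ h
  · intro h
    rw [isAcyclic_iff_forall_adj_isBridge]
    rintro ⟨u, i⟩ ⟨v, j⟩ ⟨hij, huv⟩
    obtain rfl : i = j := hij
    have hb := isAcyclic_iff_forall_adj_isBridge.1 (h i) huv
    rw [isBridge_iff] at hb ⊢
    refine fun hr => hb ?_
    -- Deleting the edge in copy `i` gives again a disjoint union of three graphs, with only the
    -- `i`-th one altered, so reachability reduces to that copy.
    have hle : (copies A).deleteEdges {s((u, i), (v, i))} ≤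
        copies (fun j => (A j).deleteEdges {e | j = i ∧ e = s(u, v)}) := by
      rintro ⟨x, j⟩ ⟨y, k⟩ hxy
      rw [deleteEdges_adj] at hxy
      obtain ⟨⟨hjk, hxy⟩, hne⟩ := hxy
      obtain rfl : j = k := hjk
      refine ⟨rfl, ?_⟩
      rw [deleteEdges_adj]
      refine ⟨hxy, ?_⟩
      rintro ⟨rfl, he⟩
      refine hne ?_
      simp only [Sym2.eq_iff] at he
      rcases he with ⟨rfl, rfl⟩ | ⟨rfl, rfl⟩
      · rfl
      · exact Sym2.eq_swap
    have := (copies_reachable_iff.1 (hr.mono hle)).2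
    simpa using this

theorem fin_three_add_one_ne (k : Fin 3) : k + 1 ≠ k + 2 := by
  revert k
  decide

theorem bridge_adj_iff {κ : Fin 3 → V} {H : SimpleGraph (V × Fin 3)} {k : Fin 3} {b : Bool}
    {x y : V × Fin 3} :
    (bridge κ H k b).Adj x y ↔ H.Adj x y ∨ (b = true ∧
      ((x = (κ k, k + 1) ∧ y = (κ k, k + 2)) ∨ (x = (κ k, k + 2) ∧ y = (κ k, k + 1)))) := by
  have hk := fin_three_add_one_ne k
  cases b
  · simp [bridge]
  · simp only [bridge, cond_true, sup_adj, edge_adj, true_and]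
    refine or_congr_right (and_iff_left_of_imp ?_)
    rintro (⟨rfl, rfl⟩ | ⟨rfl, rfl⟩) h
    · exact hk (congrArg Prod.snd h)
    · exact hk (congrArg Prod.snd h).symm

theorem glue_adj_iff {κ : Fin 3 → V} {A : Fin 3 → SimpleGraph V} {S : Fin 3 → Bool}
    {x y : V × Fin 3} :
    (glue κ A S).Adj x y ↔ (x.2 = y.2 ∧ (A x.2).Adj x.1 y.1) ∨ ∃ k, S k = true ∧
      ((x = (κ k, k + 1) ∧ y = (κ k, k + 2)) ∨ (x = (κ k, k + 2) ∧ y = (κ k, k + 1))) := by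
  rw [glue, bridge_adj_iff, bridge_adj_iff, bridge_adj_iff, or_assoc, or_assoc,
    Fin.exists_fin_succ, Fin.exists_fin_two]
  rfl

theorem glue_adj_same {κ : Fin 3 → V} {A : Fin 3 → SimpleGraph V} {S : Fin 3 → Bool} {i : Fin 3}
    {u v : V} : (glue κ A S).Adj (u, i) (v, i) ↔ (A i).Adj u v := by
  rw [glue_adj_iff]
  refine ⟨?_, fun h => Or.inl ⟨rfl, h⟩⟩
  rintro (⟨-, h⟩ | ⟨k, -, ⟨h, h'⟩ | ⟨h, h'⟩⟩)
  · exact h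
  · exact absurd ((Prod.mk.inj h).2.symm.trans (Prod.mk.inj h').2) (fin_three_add_one_ne k)
  · exact absurd ((Prod.mk.inj h).2.symm.trans (Prod.mk.inj h').2) (fin_three_add_one_ne k).symm

theorem glue_adj_bridge {κ : Fin 3 → V} {A : Fin 3 → SimpleGraph V} {S : Fin 3 → Bool}
    {k : Fin 3} : (glue κ A S).Adj (κ k, k + 1) (κ k, k + 2) ↔ S k = true := by
  rw [glue_adj_iff]
  refine ⟨?_, fun h => Or.inr ⟨k, h, Or.inl ⟨rfl, rfl⟩⟩⟩
  rintro (⟨h, -⟩ | ⟨l, hl, ⟨h, h'⟩ | ⟨h, h'⟩⟩)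
  · exact absurd h (fin_three_add_one_ne k)
  · have h2 : k = l := by simpa using congrArg Prod.snd h
    exact h2 ▸ hl
  -- Two bridges cannot coincide with their ends exchanged: `k = l + 1` modulo 3 gives `k + 2 = l`.
  · have hkl : ∀ k l : Fin 3, k + 1 = l + 2 → k + 2 ≠ l + 1 := by decide
    exact absurd (Prod.mk.inj h').2 (hkl k l (Prod.mk.inj h).2)

theorem glue_injective {κ : Fin 3 → V} {A B : Fin 3 → SimpleGraph V} {S T : Fin 3 → Bool}
    (h : glue κ A S = glue κ B T) : A = B ∧ S = T := by
  constructor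
  · funext i
    ext u v
    rw [← glue_adj_same (κ := κ) (A := A) (S := S), h, glue_adj_same]
  · funext k
    rw [Bool.eq_iff_iff, ← glue_adj_bridge (κ := κ) (A := A) (S := S), h, glue_adj_bridge]

theorem glue_le_glue_iff {κ : Fin 3 → V} {G : SimpleGraph V} {A : Fin 3 → SimpleGraph V}
    {S : Fin 3 → Bool} : glue κ A S ≤ glue κ (fun _ => G) (fun _ => true) ↔ ∀ i, A i ≤ G := by
  constructor
  · intro h i u v huv
    exact glue_adj_same.1 (h (glue_adj_same.2 huv : (glue κ A S).Adj (u, i) (v, i)))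
  · intro h x y hxy
    rw [glue_adj_iff] at hxy ⊢
    rcases hxy with ⟨h1, h2⟩ | ⟨k, -, hk⟩
    · exact Or.inl ⟨h1, h _ h2⟩
    · exact Or.inr ⟨k, rfl, hk⟩

open Classical in
theorem exists_eq_glue {κ : Fin 3 → V} {G : SimpleGraph V} {F : SimpleGraph (V × Fin 3)}
    (hF : F ≤ glue κ (fun _ => G) (fun _ => true)) : ∃ A S, F = glue κ A S := by
  refine ⟨fun i => F.comap (fun v => (v, i)), fun k => decide (F.Adj (κ k, k + 1) (κ k, k + 2)), ?_⟩
  ext ⟨u, i⟩ ⟨v, j⟩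
  rw [glue_adj_iff]
  constructor
  · intro h
    rcases glue_adj_iff.1 (hF h) with ⟨h1, -⟩ | ⟨k, -, ⟨hx, hy⟩ | ⟨hx, hy⟩⟩
    · obtain rfl : i = j := h1
      exact Or.inl ⟨rfl, h⟩
    · rw [hx, hy] at h ⊢
      exact Or.inr ⟨k, decide_eq_true h, Or.inl ⟨rfl, rfl⟩⟩
    · rw [hx, hy] at h ⊢
      exact Or.inr ⟨k, decide_eq_true h.symm, Or.inr ⟨rfl, rfl⟩⟩
  · rintro (⟨h1, h2⟩ | ⟨k, hk, ⟨hx, hy⟩ | ⟨hx, hy⟩⟩)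
    · obtain rfl : i = j := h1
      exact h2
    · rw [hx, hy]
      exact of_decide_eq_true hk
    · rw [hx, hy]
      exact (of_decide_eq_true hk).symm

/-- `R` describes the connections in `H` between the corners of the copies. -/
def CornersConnectedBy (κ : Fin 3 → V) (H : SimpleGraph (V × Fin 3))
    (R : Fin 3 × Fin 3 → Fin 3 × Fin 3 → Bool) : Prop :=
  ∀ x y : Fin 3 × Fin 3, H.Reachable (κ x.1, x.2) (κ y.1, y.2) ↔ R x y = true

theorem CornersConnectedBy.bridge {κ : Fin 3 → V} {H : SimpleGraph (V × Fin 3)}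
    {R : Fin 3 × Fin 3 → Fin 3 × Fin 3 → Bool} (h : CornersConnectedBy κ H R) (k : Fin 3)
    (b : Bool) : CornersConnectedBy κ (bridge κ H k b) (bridgeRel R k b) := by
  cases b
  · exact h
  · intro x y
    simp only [SimpleGraph.bridge, bridgeRel, cond_true, linkRel, Bool.or_eq_true,
      Bool.and_eq_true, or_assoc]
    rw [reachable_sup_edge_iff, ← h, ← h, ← h, ← h, ← h]

theorem CornersConnectedBy.bridge_isAcyclic_iff {κ : Fin 3 → V} {H : SimpleGraph (V × Fin 3)}
    {R : Fin 3 × Fin 3 → Fin 3 × Fin 3 → Bool} (h : CornersConnectedBy κ H R) {k : Fin 3}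
    (hk : ¬ H.Adj (κ k, k + 1) (κ k, k + 2)) (b : Bool) :
    (SimpleGraph.bridge κ H k b).IsAcyclic ↔ H.IsAcyclic ∧ bridgeOk R k b = true := by
  cases b
  · simp [SimpleGraph.bridge, bridgeOk]
  · have hne : ((κ k, k + 1) : V × Fin 3) ≠ (κ k, k + 2) := 
      fun h => fin_three_add_one_ne k (Prod.mk.inj h).2
    simp only [SimpleGraph.bridge, bridgeOk, cond_true, isAcyclic_sup_fromEdgeSet_iff, hne, hk,
      or_self, Bool.true_and, imp_false]
    rw [h (k, k + 1) (k, k + 2)]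
    simp

/-- Both ends of a bridge are corners, so a path to a corner that uses the bridge has already met
one. -/
theorem exists_bridge_reachable_iff {κ : Fin 3 → V} {H : SimpleGraph (V × Fin 3)} {k : Fin 3}
    {b : Bool} {v : V × Fin 3} :
    (∃ x : Fin 3 × Fin 3, (bridge κ H k b).Reachable v (κ x.1, x.2)) ↔
      ∃ x : Fin 3 × Fin 3, H.Reachable v (κ x.1, x.2) := by
  cases b
  · rfl
  · simp only [bridge, cond_true, reachable_sup_edge_iff]
    constructor
    · rintro ⟨x, h | ⟨h, -⟩ | ⟨h, -⟩⟩
      exacts [⟨x, h⟩, ⟨(k, k + 1), h⟩, ⟨(k, k + 2), h⟩]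
    · rintro ⟨x, h⟩
      exact ⟨x, Or.inl h⟩

theorem exists_glue_reachable_iff {κ : Fin 3 → V} {A : Fin 3 → SimpleGraph V} {S : Fin 3 → Bool}
    {v : V} {i : Fin 3} :
    (∃ x : Fin 3 × Fin 3, (glue κ A S).Reachable (v, i) (κ x.1, x.2)) ↔
      ∃ j, (A i).Reachable v (κ j) := by
  simp only [glue, exists_bridge_reachable_iff, copies_reachable_iff]
  exact ⟨fun ⟨x, _, h⟩ => ⟨x.1, h⟩, fun ⟨j, h⟩ => ⟨(j, i), rfl, h⟩⟩

theorem cornersConnectedBy_copies {κ : Fin 3 → V} {A : Fin 3 → SimpleGraph V}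
    {p : Fin 3 → CornerPartition}
    (h : ∀ i j k, (A i).Reachable (κ j) (κ k) ↔ (p i).rel j k = true) :
    CornersConnectedBy κ (copies A) (copiesRel p) := by
  intro x y
  simp [copies_reachable_iff, h, copiesRel]

theorem cornersConnectedBy_glue {κ : Fin 3 → V} {A : Fin 3 → SimpleGraph V}
    {p : Fin 3 → CornerPartition}
    (h : ∀ i j k, (A i).Reachable (κ j) (κ k) ↔ (p i).rel j k = true) (S : Fin 3 → Bool) :
    CornersConnectedBy κ (glue κ A S) (glueRel p S) :=
  (((cornersConnectedBy_copies h).bridge 0 _).bridge 1 _).bridge 2 _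

/-- The bridges are added one at a time; each is a new edge, so it keeps the graph acyclic exactly
when its ends were not yet connected. -/
theorem glue_isAcyclic_iff {κ : Fin 3 → V} {A : Fin 3 → SimpleGraph V}
    {p : Fin 3 → CornerPartition}
    (h : ∀ i j k, (A i).Reachable (κ j) (κ k) ↔ (p i).rel j k = true) (S : Fin 3 → Bool) :
    (glue κ A S).IsAcyclic ↔ (∀ i, (A i).IsAcyclic) ∧
      bridgeOk (copiesRel p) 0 (S 0) = true ∧
      bridgeOk (bridgeRel (copiesRel p) 0 (S 0)) 1 (S 1) = true ∧
      bridgeOk (bridgeRel (bridgeRel (copiesRel p) 0 (S 0)) 1 (S 1)) 2 (S 2) = true := by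
  have h0 := cornersConnectedBy_copies h
  have h1 := h0.bridge 0 (S 0)
  have h2 := h1.bridge 1 (S 1)
  rw [glue, h2.bridge_isAcyclic_iff, h1.bridge_isAcyclic_iff, h0.bridge_isAcyclic_iff,
    copies_isAcyclic_iff, and_assoc, and_assoc]
  · simp [copies]
  · simp [bridge_adj_iff, copies]
  · simp [bridge_adj_iff, copies]

theorem IsAcyclic.of_glue {κ : Fin 3 → V} {A : Fin 3 → SimpleGraph V} {S : Fin 3 → Bool}
    (h : (glue κ A S).IsAcyclic) (i : Fin 3) : (A i).IsAcyclic := by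
  have : (glue κ A S).comap (fun v => (v, i)) = A i := by
    ext u v
    exact glue_adj_same
  rw [← this]
  exact IsAcyclic.of_comap ⟨fun v => (v, i), fun u v h => congrArg Prod.fst h⟩ h

/-- This reduces a question about forests to a Boolean computation that involves neither `V` nor
`G`. -/
theorem glue_mem_cornerForests_iff {κ : Fin 3 → V} {G : SimpleGraph V} {A : Fin 3 → SimpleGraph V}
    {p : Fin 3 → CornerPartition} (hA : ∀ i, A i ∈ G.cornerForests κ (p i)) {S : Fin 3 → Bool}
    {t : CornerPartition} :
    glue κ A S ∈ (glue κ (fun _ => G) (fun _ => true)).cornerForests (fun i => (κ i, i)) t ↔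
      glueOk p S t = true := by
  have hrel := fun i => (hA i).2.2.2
  have hc := cornersConnectedBy_glue hrel S
  -- Each vertex already reaches a corner of its own copy, so only the nine corners need to reach an
  -- outer corner.
  have hspan : (∀ v, ∃ i, (glue κ A S).Reachable v (κ i, i)) ↔
      ∀ i j, ∃ k, glueRel p S (j, i) (k, k) = true := by
    constructor
    · intro h i j
      obtain ⟨k, hk⟩ := h (κ j, i)
      exact ⟨k, (hc (j, i) (k, k)).1 hk⟩
    · rintro h ⟨v, i⟩
      obtain ⟨x, hx⟩ := exists_glue_reachable_iff.2 ((hA i).2.2.1 v)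
      obtain ⟨k, hk⟩ := h x.2 x.1
      exact ⟨k, hx.trans ((hc x (k, k)).2 hk)⟩
  have hcor : (∀ i j, (glue κ A S).Reachable (κ i, i) (κ j, j) ↔ t.rel i j = true) ↔
      ∀ i j, glueRel p S (i, i) (j, j) = t.rel i j := by
    refine forall_congr' fun i => forall_congr' fun j => ?_
    rw [hc (i, i) (j, j)]
    exact Bool.eq_iff_iff.symm
  simp only [cornerForests, Set.mem_ofPred_eq, glue_le_glue_iff, glue_isAcyclic_iff hrel, hspan,
    hcor, glueOk, Bool.and_eq_true, List.all_eq_true, List.any_eq_true, List.mem_finRange,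
    true_and, beq_iff_eq, forall_const]
  have h1 : ∀ i, A i ≤ G := fun i => (hA i).1
  have h2 : ∀ i, (A i).IsAcyclic := fun i => (hA i).2.1
  tauto

theorem exists_mem_cornerForests_of_glue {κ : Fin 3 → V} {G : SimpleGraph V}
    {A : Fin 3 → SimpleGraph V} {S : Fin 3 → Bool} {t : CornerPartition}
    (h : glue κ A S ∈
      (glue κ (fun _ => G) (fun _ => true)).cornerForests (fun i => (κ i, i)) t) (i : Fin 3) :
    ∃ s, A i ∈ G.cornerForests κ s := by
  obtain ⟨h1, h2, h3, -⟩ := h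
  obtain ⟨s, hs⟩ := CornerPartition.exists_rel (r := fun j k => (A i).Reachable (κ j) (κ k))
    ⟨fun _ => .rfl, .symm, .trans⟩
  refine ⟨s, glue_le_glue_iff.1 h1 i, h2.of_glue i, fun v => ?_, hs⟩
  obtain ⟨k, hk⟩ := h3 (v, i)
  exact exists_glue_reachable_iff.1 ⟨(k, k), hk⟩

theorem eq_of_mem_cornerForests {κ : Fin 3 → V} {G F : SimpleGraph V} {s t : CornerPartition}
    (hs : F ∈ G.cornerForests κ s) (ht : F ∈ G.cornerForests κ t) : s = t :=
  CornerPartition.rel_injective fun i j => by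
    rw [Bool.eq_iff_iff, ← hs.2.2.2, ht.2.2.2]

-- A forest of the glued graph determines its three restrictions, their partitions and its bridges,
-- so the admissible data `((p, S), A)` correspond to it bijectively.
set_option linter.constructorNameAsVariable false in
open Classical in
theorem ncard_cornerForests_glue [Finite V] (κ : Fin 3 → V) (G : SimpleGraph V)
    (t : CornerPartition) :
    ((glue κ (fun _ => G) (fun _ => true)).cornerForests (fun i => (κ i, i)) t).ncard =
      ∑ x : (Fin 3 → CornerPartition) × (Fin 3 → Bool) with glueOk x.1 x.2 t = true,
        ∏ i, (G.cornerForests κ (x.1 i)).ncard := by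
  have hfin : ∀ s, (G.cornerForests κ s).Finite := fun s => Set.toFinite _
  have hfin' := Set.toFinite
    ((glue κ (fun _ => G) (fun _ => true)).cornerForests (fun i => (κ i, i)) t)
  simp only [fun s => Set.ncard_eq_toFinset_card _ (hfin s), Set.ncard_eq_toFinset_card _ hfin',
    ← Fintype.card_piFinset]
  rw [← Finset.card_sigma]
  symm
  refine Finset.card_bij (fun y _ => glue κ y.2 y.1.2) ?_ ?_ ?_
  · rintro ⟨⟨p, S⟩, A⟩ h
    simp only [Finset.mem_sigma, Finset.mem_filter, Finset.mem_univ, true_and,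
      Fintype.mem_piFinset, Set.Finite.mem_toFinset] at h ⊢
    exact (glue_mem_cornerForests_iff h.2).2 h.1
  · rintro ⟨⟨p, S⟩, A⟩ h ⟨⟨q, T⟩, B⟩ h' heq
    simp only [Finset.mem_sigma, Finset.mem_filter, Finset.mem_univ, true_and,
      Fintype.mem_piFinset, Set.Finite.mem_toFinset] at h h'
    obtain ⟨rfl, rfl⟩ := glue_injective heq
    obtain rfl : p = q := funext fun i => eq_of_mem_cornerForests (h.2 i) (h'.2 i)
    rfl
  · intro F hF
    rw [Set.Finite.mem_toFinset] at hF
    obtain ⟨A, S, rfl⟩ := exists_eq_glue hF.1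
    choose p hp using exists_mem_cornerForests_of_glue hF
    refine ⟨⟨(p, S), A⟩, ?_, rfl⟩
    simp only [Finset.mem_sigma, Finset.mem_filter, Finset.mem_univ, true_and,
      Fintype.mem_piFinset, Set.Finite.mem_toFinset]
    exact ⟨(glue_mem_cornerForests_iff hp).1 hF, hp⟩

theorem ncard_cornerForests_comap {W : Type*} (φ : V ≃ W) (G : SimpleGraph W) (κ : Fin 3 → V)
    (t : CornerPartition) :
    ((G.comap φ).cornerForests κ t).ncard = (G.cornerForests (fun i => φ (κ i)) t).ncard := by
  have hmem : ∀ F : SimpleGraph W, F.comap φ ∈ (G.comap φ).cornerForests κ t ↔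
      F ∈ G.cornerForests (fun i => φ (κ i)) t := by
    intro F
    have hiso : ∀ u v, (F.comap φ).Reachable u v ↔ F.Reachable (φ u) (φ v) :=
      fun u v => (Iso.reachable_iff (φ := Iso.comap φ F)).symm
    simp only [cornerForests, Set.mem_ofPred_eq, hiso, (Iso.comap φ F).isAcyclic_iff]
    refine and_congr ?_ (and_congr_right fun _ => and_congr_left fun _ => ?_)
    · constructor
      · intro h u v huv
        simpa using h (show (F.comap φ).Adj (φ.symm u) (φ.symm v) by simpa using huv)
      · exact fun h u v huv => h huv
    · exact ⟨fun h w => by simpa using h (φ.symm w), fun h v => h _⟩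
  have himage : (G.comap φ).cornerForests κ t =
      (fun F => F.comap φ) '' G.cornerForests (fun i => φ (κ i)) t := by
    ext F
    constructor
    · intro h
      have hF : (F.comap φ.symm).comap φ = F := by
        ext u v
        simp
      exact ⟨F.comap φ.symm, (hmem _).1 (by rwa [hF]), hF⟩
    · rintro ⟨F, h, rfl⟩
      exact (hmem F).2 h
  rw [himage, Set.ncard_image_of_injective]
  intro F F' h
  ext u v
  simpa using congrFun₂ (congrArg Adj h) (φ.symm u) (φ.symm v)

end Glue

end SimpleGraph
-- Enumeration of the gluing configurations
open Finset in
/-- The numbers of partitions with two and with three blocks among three partitions. -/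
def blockProfile (p : Fin 3 → CornerPartition) : ℕ × ℕ :=
  (#{i | (p i).kind = 1}, #{i | (p i).kind = 2})

/-- The block profiles of the configurations that give a partition with `t + 1` blocks. -/
def gluingProfiles (t : Fin 3) : Multiset (ℕ × ℕ) :=
  match t with
  | 0 => .replicate 3 (0, 0) + .replicate 6 (1, 0)
  | 1 => .replicate 1 (0, 0) + .replicate 7 (1, 0) + .replicate 7 (2, 0) + .replicate 1 (0, 1)
  | 2 => .replicate 3 (0, 1) + .replicate 12 (1, 1) + .replicate 14 (3, 0) +
      .replicate 12 (1, 0) + .replicate 1 (0, 0) + .replicate 36 (2, 0)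

-- For each of the five `t`, all 5³ · 2³ = 1000 configurations are checked. The right side depends
-- on `t.kind` only, which is the source of the symmetry between corners.
set_option maxRecDepth 100000 in
theorem map_blockProfile_glueOk (t : CornerPartition) :
    ((Finset.univ.filter fun x : (Fin 3 → CornerPartition) × (Fin 3 → Bool) =>
      glueOk x.1 x.2 t = true).val.map fun x => blockProfile x.1) = gluingProfiles t.kind := by
  revert t
  decide +kernel

/-- The block profile turns a configuration into a monomial. The truncated subtraction is exact, as
the two numbers count disjoint sets of copies. -/
theorem prod_kind (f : Fin 3 → ℕ) (p : Fin 3 → CornerPartition) :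
    ∏ i, f (p i).kind =
      f 0 ^ (3 - (blockProfile p).1 - (blockProfile p).2) * f 1 ^ (blockProfile p).1 *
        f 2 ^ (blockProfile p).2 := by
  simp only [blockProfile, Finset.card_filter, Fin.sum_univ_three, Fin.prod_univ_three]
  generalize (p 0).kind = x
  generalize (p 1).kind = y
  generalize (p 2).kind = z
  have h3 : ∀ k : Fin 3, k = 0 ∨ k = 1 ∨ k = 2 := by decide
  rcases h3 x with rfl | rfl | rfl <;> rcases h3 y with rfl | rfl | rfl <;>
    rcases h3 z with rfl | rfl | rfl <;>
    simp only [reduceIte, Fin.reduceEq, Nat.reduceAdd, Nat.reduceSub] <;> ring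

/-- The right-hand sides of the recursion formulas. -/
def gluingPoly (f : Fin 3 → ℕ) (t : Fin 3) : ℕ :=
  match t with
  | 0 => 3 * f 0 ^ 3 + 6 * f 0 ^ 2 * f 1
  | 1 => f 0 ^ 3 + 7 * f 0 ^ 2 * f 1 + 7 * f 0 * f 1 ^ 2 + f 0 ^ 2 * f 2
  | 2 => 3 * f 0 ^ 2 * f 2 + 12 * f 0 * f 1 * f 2 + 14 * f 1 ^ 3 + 12 * f 0 ^ 2 * f 1 + f 0 ^ 3 +
      36 * f 0 * f 1 ^ 2

theorem sum_glueOk (f : Fin 3 → ℕ) (t : CornerPartition) :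
    ∑ x : (Fin 3 → CornerPartition) × (Fin 3 → Bool) with glueOk x.1 x.2 t = true,
      ∏ i, f (x.1 i).kind = gluingPoly f t.kind := by
  have key : ∀ s : Finset ((Fin 3 → CornerPartition) × (Fin 3 → Bool)),
      s.val.map (fun x => blockProfile x.1) = gluingProfiles t.kind →
      ∑ x ∈ s, ∏ i, f (x.1 i).kind = gluingPoly f t.kind := by
    intro s hs
    have h := congrArg (fun m => (m.map fun a : ℕ × ℕ =>
      f 0 ^ (3 - a.1 - a.2) * f 1 ^ a.1 * f 2 ^ a.2).sum) hs
    simp only [Multiset.map_map, Function.comp_def] at h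
    rw [Finset.sum_congr rfl fun x _ => prod_kind f x.1, Finset.sum_eq_multiset_sum, h]
    match t.kind with
    | 0 | 1 | 2 =>
      simp only [gluingProfiles, gluingPoly, Multiset.map_add, Multiset.map_replicate,
        Multiset.sum_add, Multiset.sum_replicate, smul_eq_mul, Nat.reduceSub]
      ring
  exact key _ (map_blockProfile_glueOk t)

/-! ### Self-similarity of the Schreier graphs -/

theorem HanoiGen.selfLetter_bijective : Function.Bijective HanoiGen.selfLetter := by
  constructor
  · intro g h
    cases g <;> cases h <;> simp [HanoiGen.selfLetter]
  · intro k
    fin_cases k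
    exacts [⟨.c, rfl⟩, ⟨.b, rfl⟩, ⟨.a, rfl⟩]

theorem HanoiGen.rootPerm_eq_iff (g : HanoiGen) {x y : Fin 3} (h : x ≠ y) :
    g.rootPerm x = y ↔ (x = g.selfLetter + 1 ∧ y = g.selfLetter + 2) ∨
      (x = g.selfLetter + 2 ∧ y = g.selfLetter + 1) := by
  cases g <;> revert x y <;> simp only [rootPerm, selfLetter] <;> decide

theorem HanoiGen.rootPerm_selfLetter (g : HanoiGen) : g.rootPerm g.selfLetter = g.selfLetter := by
  cases g <;> decide

/-- The recursion passes a letter only if it is the self letter, so it reaches `y` only if all of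
`w` consists of it; the self letter is itself fixed by `rootPerm`. -/
theorem HanoiGen.act_append (g : HanoiGen) (w : List (Fin 3)) (y : Fin 3) :
    g.act (w ++ [y]) = if w = List.replicate w.length g.selfLetter then w ++ [g.rootPerm y]
      else g.act w ++ [y] := by
  induction w with
  | nil => simp [act]
  | cons x w ih =>
    by_cases hx : x = g.selfLetter
    · subst hx
      simp only [List.cons_append, act, if_true, ih, rootPerm_selfLetter, List.length_cons,
        List.replicate_succ, List.cons.injEq, true_and]
      split_ifs <;> rfl
    · simp [act, hx, List.replicate_succ]

theorem HanoiGen.levelAct_snoc (g : HanoiGen) {n : ℕ} (w : List.Vector (Fin 3) n) (y : Fin 3) :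
    g.levelAct (w.snoc y) = if w = hanoiCorner n g.selfLetter then w.snoc (g.rootPerm y)
      else (g.levelAct w).snoc y := by
  have hw : w = hanoiCorner n g.selfLetter ↔
      w.toList = List.replicate w.toList.length g.selfLetter := by
    rw [List.Vector.toList_length]
    exact ⟨congrArg List.Vector.toList, fun h => List.Vector.eq _ _ h⟩
  have h := g.act_append w.toList y
  split_ifs with hc
  · rw [if_pos (hw.1 hc)] at h
    exact Subtype.ext h
  · rw [if_neg (mt hw.2 hc)] at h
    exact Subtype.ext h

theorem HanoiGen.levelAct_hanoiCorner (g : HanoiGen) (n : ℕ) :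
    g.levelAct (hanoiCorner n g.selfLetter) = hanoiCorner n g.selfLetter := by
  induction n with
  | zero => exact Subsingleton.elim _ _
  | succ n ih =>
    rw [hanoiCorner, List.Vector.replicate_succ_to_snoc, levelAct_snoc, ← hanoiCorner, if_pos rfl,
      rootPerm_selfLetter]

/-- A word of length `n + 1` is a word of length `n` followed by a letter. -/
noncomputable def snocEquiv (n : ℕ) : List.Vector (Fin 3) n × Fin 3 ≃ List.Vector (Fin 3) (n + 1) :=
  Equiv.ofBijective (fun x => x.1.snoc x.2) <| by
    constructor
    · rintro ⟨⟨v, hv⟩, x⟩ ⟨⟨w, hw⟩, y⟩ h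
      have h' : v ++ [x] = w ++ [y] := congrArg Subtype.val h
      obtain ⟨rfl, h2⟩ := List.append_inj' h' rfl
      simp_all
    · rintro ⟨l, hl⟩
      have hne : l ≠ [] := List.ne_nil_of_length_eq_add_one hl
      exact ⟨(⟨l.dropLast, by simp [hl]⟩, l.getLast hne),
        Subtype.ext (List.dropLast_append_getLast hne)⟩

theorem snocEquiv_corner (n : ℕ) (i : Fin 3) :
    snocEquiv n (hanoiCorner n i, i) = hanoiCorner (n + 1) i :=
  (List.Vector.replicate_succ_to_snoc i).symm

/-- The loop of `g` at the corner of its self letter is what opens into a bridge. No edge inside a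
copy is lost, since `g` moves every word that it joins to a different one. -/
theorem comap_snocEquiv_hanoiGraph (n : ℕ) :
    (hanoiGraph (n + 1)).comap (snocEquiv n) =
      SimpleGraph.glue (hanoiCorner n) (fun _ => hanoiGraph n) (fun _ => true) := by
  ext ⟨u, x⟩ ⟨v, y⟩
  have hinj : ∀ {u v : List.Vector (Fin 3) n} {x y : Fin 3},
      u.snoc x = v.snoc y ↔ u = v ∧ x = y := fun {u v x y} =>
    ((snocEquiv n).injective.eq_iff (a := (u, x)) (b := (v, y))).trans Prod.mk_inj
  have hfix : ∀ {g : HanoiGen} {v : List.Vector (Fin 3) n}, u ≠ v → g.levelAct u = v →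
      u ≠ hanoiCorner n g.selfLetter := by
    rintro g v hne hg rfl
    exact hne ((g.levelAct_hanoiCorner n).symm.trans hg)
  rw [SimpleGraph.glue_adj_iff]
  change (u.snoc x ≠ v.snoc y ∧ ∃ g : HanoiGen, g.levelAct (u.snoc x) = v.snoc y) ↔
    (x = y ∧ u ≠ v ∧ ∃ g : HanoiGen, g.levelAct u = v) ∨ _
  simp only [Prod.mk_inj]
  constructor
  · rintro ⟨hne, g, hg⟩
    rw [HanoiGen.levelAct_snoc] at hg
    split_ifs at hg with hu
    · obtain ⟨rfl, hxy⟩ := hinj.1 hg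
      have hne' : x ≠ y := fun h => hne (hinj.2 ⟨rfl, h⟩)
      refine Or.inr ⟨g.selfLetter, trivial, ?_⟩
      exact ((g.rootPerm_eq_iff hne').1 hxy).imp (fun h => ⟨⟨hu, h.1⟩, hu, h.2⟩)
        fun h => ⟨⟨hu, h.1⟩, hu, h.2⟩
    · obtain ⟨h1, rfl⟩ := hinj.1 hg
      exact Or.inl ⟨rfl, fun h => hne (hinj.2 ⟨h, rfl⟩), g, h1⟩
  · rintro (⟨rfl, hne, g, hg⟩ | ⟨k, -, h⟩)
    · refine ⟨fun h => hne (hinj.1 h).1, g, ?_⟩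
      rw [HanoiGen.levelAct_snoc, if_neg (hfix hne hg), hg]
    · obtain ⟨g, rfl⟩ := HanoiGen.selfLetter_bijective.2 k
      have hu : u = hanoiCorner n g.selfLetter := h.elim (fun h => h.1.1) fun h => h.1.1
      have hv : v = hanoiCorner n g.selfLetter := h.elim (fun h => h.2.1) fun h => h.2.1
      have h' := h.imp (fun h => And.intro h.1.2 h.2.2) fun h => And.intro h.1.2 h.2.2
      have hne : x ≠ y := by
        have h12 := SimpleGraph.fin_three_add_one_ne g.selfLetter
        rcases h' with ⟨rfl, rfl⟩ | ⟨rfl, rfl⟩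
        exacts [h12, h12.symm]
      refine ⟨fun h => hne (hinj.1 h).2, g, ?_⟩
      rw [HanoiGen.levelAct_snoc, if_pos hu, (g.rootPerm_eq_iff hne).2 h', hu, hv]

theorem ncard_cornerForests_hanoiGraph_succ (n : ℕ) (t : CornerPartition) (f : Fin 3 → ℕ)
    (hf : ∀ s, ((hanoiGraph n).cornerForests (hanoiCorner n) s).ncard = f s.kind) :
    ((hanoiGraph (n + 1)).cornerForests (hanoiCorner (n + 1)) t).ncard = gluingPoly f t.kind := by
  have h := SimpleGraph.ncard_cornerForests_comap (snocEquiv n) (hanoiGraph (n + 1))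
    (fun i => (hanoiCorner n i, i)) t
  simp only [snocEquiv_corner] at h
  rw [show (fun i => hanoiCorner (n + 1) i) = hanoiCorner (n + 1) from rfl] at h
  rw [← h, comap_snocEquiv_hanoiGraph, SimpleGraph.ncard_cornerForests_glue, ← sum_glueOk]
  simp only [hf]

/-! ### The families of the theorem as corner forests -/

theorem hanoiTrees_eq (n : ℕ) :
    hanoiTrees n = (hanoiGraph n).cornerForests (hanoiCorner n) .joined := by
  ext F
  simp only [hanoiTrees, SimpleGraph.cornerForests, Set.mem_ofPred_eq, CornerPartition.rel,
    iff_true]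
  refine and_congr_right fun _ => ⟨fun h => ?_, fun ⟨h1, h2, h3⟩ => ?_⟩
  · exact ⟨h.isAcyclic, fun v => ⟨0, h.connected.preconnected _ _⟩,
      fun i j => h.connected.preconnected _ _⟩
  · refine @SimpleGraph.IsTree.mk _ _ (@SimpleGraph.Connected.mk _ _ (fun u v => ?_) ⟨hanoiCorner n 0⟩) h1
    obtain ⟨i, hi⟩ := h2 u
    obtain ⟨j, hj⟩ := h2 v
    exact hi.trans ((h3 i j).trans hj.symm)

/-- The representatives `c i` inject into the finite set of components, so there are `k` components
exactly when this injection is onto. -/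
theorem SimpleGraph.exists_reachable_iff_card_connectedComponent {V : Type*} [Finite V]
    {F : SimpleGraph V} {k : ℕ} {c : Fin k → V} (hc : ∀ i j, i ≠ j → ¬ F.Reachable (c i) (c j)) :
    Nat.card F.ConnectedComponent = k ↔ ∀ v, ∃ i, F.Reachable v (c i) := by
  have hinj : Function.Injective fun i => F.connectedComponentMk (c i) := fun i j hij => by
    by_contra hne
    exact hc i j hne (ConnectedComponent.exact hij)
  have hsurj : (∀ v, ∃ i, F.Reachable v (c i)) ↔
      Function.Surjective fun i => F.connectedComponentMk (c i) := by
    constructor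
    · intro h x
      induction x using ConnectedComponent.ind with
      | h v =>
        obtain ⟨i, hi⟩ := h v
        exact ⟨i, ConnectedComponent.sound hi.symm⟩
    · intro h v
      obtain ⟨i, hi⟩ := h (F.connectedComponentMk v)
      exact ⟨i, (ConnectedComponent.exact hi).symm⟩
  rw [hsurj]
  constructor
  · intro h
    exact ((Nat.bijective_iff_injective_and_card _).2 ⟨hinj, by simp [h]⟩).2
  · intro h
    simpa using (Nat.card_eq_of_bijective _ ⟨hinj, h⟩).symm

theorem hanoiThreeForests_eq (n : ℕ) :
    hanoiThreeForests n = (hanoiGraph n).cornerForests (hanoiCorner n) .discrete := by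
  ext F
  simp only [hanoiThreeForests, IsSpanningForest, SimpleGraph.cornerForests, Set.mem_ofPred_eq,
    CornerPartition.rel, beq_iff_eq, and_assoc]
  have hrel : (∀ i j, F.Reachable (hanoiCorner n i) (hanoiCorner n j) ↔ i = j) ↔
      ∀ i j, i ≠ j → ¬ F.Reachable (hanoiCorner n i) (hanoiCorner n j) := by
    refine forall_congr' fun i => forall_congr' fun j => ⟨fun h => mt h.1, fun h => ?_⟩
    exact ⟨fun hr => by_contra fun hne => h hne hr, fun h => h ▸ .rfl⟩
  rw [hrel]
  refine and_congr_right fun _ => and_congr_right fun _ => and_congr_left fun h => ?_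
  exact SimpleGraph.exists_reachable_iff_card_connectedComponent h

theorem hanoiTwoForests_eq (n : ℕ) (i : Fin 3) :
    hanoiTwoForests n i = (hanoiGraph n).cornerForests (hanoiCorner n) (.isolating i) := by
  ext F
  simp only [hanoiTwoForests, IsSpanningForest, SimpleGraph.cornerForests, Set.mem_ofPred_eq,
    CornerPartition.rel, beq_iff_eq, and_assoc]
  have hrel : (∀ j k, F.Reachable (hanoiCorner n j) (hanoiCorner n k) ↔ (j == i) = (k == i)) ↔
      (∀ j k, j ≠ i → k ≠ i → F.Reachable (hanoiCorner n j) (hanoiCorner n k)) ∧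
        ∀ j, j ≠ i → ¬ F.Reachable (hanoiCorner n i) (hanoiCorner n j) := by
    constructor
    · intro h
      exact ⟨fun j k hj hk => (h j k).2 (by simp [hj, hk]), fun j hj => by simp [h, hj]⟩
    · rintro ⟨h1, h2⟩ j k
      by_cases hj : j = i <;> by_cases hk : k = i
      · simp [hj, hk]
      · subst hj
        simp [h2 k hk, hk]
      · subst hk
        simp [mt SimpleGraph.Reachable.symm (h2 j hj), hj]
      · simp [h1 j k hj hk, hj, hk]
  rw [hrel]
  refine and_congr_right fun _ => and_congr_right fun _ => and_congr_left fun h => ?_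
  -- The corners `i` and `i + 1` serve as representatives of the two components.
  have hi : i + 1 ≠ i := by
    clear h hrel
    revert i
    decide
  have hc : ∀ j k : Fin 2, j ≠ k → ¬ F.Reachable (![hanoiCorner n i, hanoiCorner n (i + 1)] j)
      (![hanoiCorner n i, hanoiCorner n (i + 1)] k) := by
    simpa [Fin.forall_fin_two, SimpleGraph.reachable_comm] using h.2 _ hi
  rw [SimpleGraph.exists_reachable_iff_card_connectedComponent hc]
  refine forall_congr' fun v => ⟨?_, ?_⟩
  · rintro ⟨j, hj⟩
    fin_cases j
    exacts [⟨_, hj⟩, ⟨_, hj⟩]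
  · rintro ⟨j, hj⟩
    by_cases hji : j = i
    · exact ⟨0, hji ▸ hj⟩
    · exact ⟨1, hj.trans (h.1 j _ hji hi)⟩

/-! ### Level 0 and the induction on the level -/

/-- At level 0 the three corners coincide, so no forest separates any two of them. -/
theorem ncard_cornerForests_hanoiGraph_zero (s : CornerPartition) :
    ((hanoiGraph 0).cornerForests (hanoiCorner 0) s).ncard = ![1, 0, 0] s.kind := by
  have hne : ∀ {s : CornerPartition} {i j : Fin 3}, s.rel i j = false →
      ((hanoiGraph 0).cornerForests (hanoiCorner 0) s).ncard = 0 := by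
    intro s i j h
    rw [Set.ncard_eq_zero, Set.eq_empty_iff_forall_notMem]
    rintro F ⟨-, -, -, hF⟩
    have := (hF i j).1 (Subsingleton.elim (hanoiCorner 0 i) (hanoiCorner 0 j) ▸ .rfl)
    simp [h] at this
  cases s with
  | joined =>
    refine Set.ncard_eq_one.2 ⟨⊥, Set.eq_singleton_iff_unique_mem.2 ⟨?_, ?_⟩⟩
    · refine ⟨bot_le, SimpleGraph.IsAcyclic.of_subsingleton, fun v => ⟨0, ?_⟩, fun i j => ?_⟩
      · rw [Subsingleton.elim v (hanoiCorner 0 0)]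
      · rw [Subsingleton.elim (hanoiCorner 0 i) (hanoiCorner 0 j)]
        simp [CornerPartition.rel]
    · exact fun F _ => Subsingleton.elim _ _
  | isolating i =>
    have hi : (CornerPartition.isolating i).rel i (i + 1) = false := by
      revert i
      decide
    exact hne hi
  | discrete => exact hne (i := 0) (j := 1) rfl

theorem exists_ncard_cornerForests_hanoiGraph (n : ℕ) : ∃ f : Fin 3 → ℕ, ∀ s : CornerPartition,
    ((hanoiGraph n).cornerForests (hanoiCorner n) s).ncard = f s.kind := by
  induction n with
  | zero => exact ⟨_, ncard_cornerForests_hanoiGraph_zero⟩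
  | succ n ih =>
    obtain ⟨f, hf⟩ := ih
    exact ⟨gluingPoly f, fun s => ncard_cornerForests_hanoiGraph_succ n s f hf⟩

theorem ncard_cornerForests_hanoiGraph (n : ℕ) (t : CornerPartition) :
    ((hanoiGraph n).cornerForests (hanoiCorner n) t).ncard =
      ![hanoiTau n, hanoiS n, hanoiQCount n] t.kind := by
  obtain ⟨f, hf⟩ := exists_ncard_cornerForests_hanoiGraph n
  cases t with
  | joined => exact congrArg Set.ncard (hanoiTrees_eq n).symm
  | isolating i =>
    refine Eq.trans ?_ (congrArg Set.ncard (hanoiTwoForests_eq n 1).symm)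
    rw [hf, hf]
    rfl
  | discrete => exact congrArg Set.ncard (hanoiThreeForests_eq n).symm

theorem ncard_hanoiTwoForests (n : ℕ) (i : Fin 3) : (hanoiTwoForests n i).ncard = hanoiS n := by
  rw [hanoiTwoForests_eq, ncard_cornerForests_hanoiGraph]
  rfl

theorem vec_eq_gluingPoly (n : ℕ) (t : CornerPartition) :
    ![hanoiTau (n + 1), hanoiS (n + 1), hanoiQCount (n + 1)] t.kind =
      gluingPoly ![hanoiTau n, hanoiS n, hanoiQCount n] t.kind := by
  rw [← ncard_cornerForests_hanoiGraph, ncard_cornerForests_hanoiGraph_succ]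
  exact ncard_cornerForests_hanoiGraph n

/-! ### Generating functions at weights 1 -/

/-- Every edge of `Σ_n` carries a label, so the default weight 0 does not occur. -/
theorem hanoiWeight_one_of_adj {n : ℕ} {e : Sym2 (List.Vector (Fin 3) n)}
    (he : e ∈ (hanoiGraph n).edgeSet) : hanoiWeight n 1 1 1 e = 1 := by
  induction e with
  | h u v =>
    obtain ⟨-, g, rfl⟩ : (hanoiGraph n).Adj u v := he
    unfold hanoiWeight
    split_ifs with ha hb hc
    · rfl
    · rfl
    · rfl
    · cases g
      exacts [absurd ⟨u, rfl⟩ ha, absurd ⟨u, rfl⟩ hb, absurd ⟨u, rfl⟩ hc]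

theorem hanoiGenFun_one {n : ℕ} {𝓕 : Set (SimpleGraph (List.Vector (Fin 3) n))}
    (h : ∀ F ∈ 𝓕, F ≤ hanoiGraph n) : hanoiGenFun n 𝓕 1 1 1 = 𝓕.ncard := by
  classical
  have hw : ∀ F ∈ Finset.univ.filter (· ∈ 𝓕),
      ∏ e ∈ F.edgeFinset, hanoiWeight n 1 1 1 e = 1 := by
    intro F hF
    refine Finset.prod_eq_one fun e he => hanoiWeight_one_of_adj ?_
    exact SimpleGraph.edgeSet_mono (h F (Finset.mem_filter.1 hF).2)
      (SimpleGraph.mem_edgeFinset.1 he)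
  rw [Set.ncard_eq_toFinset_card']
  unfold hanoiGenFun
  -- `congr!` and `convert` reconcile the different decidability and finiteness instances.
  rw [Finset.sum_congr (by congr!) fun F hF => (by convert hw F (by simpa using hF))]
  simp

theorem mainTheorem12 :
    (∀ n : ℕ, 1 ≤ n →
      hanoiT n 1 1 1 = hanoiTau n ∧
      hanoiU n 1 1 1 = hanoiS n ∧ hanoiR n 1 1 1 = hanoiS n ∧ hanoiL n 1 1 1 = hanoiS n ∧
      (∀ i : Fin 3, (hanoiTwoForests n i).ncard = hanoiS n) ∧
      hanoiQ n 1 1 1 = hanoiQCount n ∧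
      hanoiTau (n + 1) = 3 * hanoiTau n ^ 3 + 6 * hanoiTau n ^ 2 * hanoiS n ∧
      hanoiS (n + 1) = hanoiTau n ^ 3 + 7 * hanoiTau n ^ 2 * hanoiS n
        + 7 * hanoiTau n * hanoiS n ^ 2 + hanoiTau n ^ 2 * hanoiQCount n ∧
      hanoiQCount (n + 1) = 3 * hanoiTau n ^ 2 * hanoiQCount n
        + 12 * hanoiTau n * hanoiS n * hanoiQCount n + 14 * hanoiS n ^ 3
        + 12 * hanoiTau n ^ 2 * hanoiS n + hanoiTau n ^ 3 + 36 * hanoiTau n * hanoiS n ^ 2) ∧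
    hanoiTau 1 = 3 ∧ hanoiS 1 = 1 ∧ hanoiQCount 1 = 1 := by
  have h2 : ∀ n i, hanoiGenFun n (hanoiTwoForests n i) 1 1 1 = hanoiS n := fun n i => by
    rw [hanoiGenFun_one fun F hF => hF.1.1, ncard_hanoiTwoForests]
  have h1 : ∀ t : CornerPartition, ![hanoiTau 1, hanoiS 1, hanoiQCount 1] t.kind =
      gluingPoly ![1, 0, 0] t.kind := fun t =>
    (ncard_cornerForests_hanoiGraph 1 t).symm.trans
      (ncard_cornerForests_hanoiGraph_succ 0 t _ ncard_cornerForests_hanoiGraph_zero)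
  refine ⟨fun n _ => ⟨?_, h2 n 1, h2 n 2, h2 n 0, ncard_hanoiTwoForests n, ?_,
    vec_eq_gluingPoly n .joined, vec_eq_gluingPoly n (.isolating 1),
    vec_eq_gluingPoly n .discrete⟩, h1 .joined, h1 (.isolating 1), h1 .discrete⟩
  · exact hanoiGenFun_one fun F hF => hF.1
  · exact hanoiGenFun_one fun F hF => hF.1.1
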